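/- Let $d\ge 1$ and $\mathbf n=(n_1,\dots,n_d)\in\mathbb N^d$ (with $0\in\mathbb N$). Let $\boldsymbol U=\{u_{\mathbf k}\in\mathbb N^d:\mathbf k\in\mathbb N^d\}$ be a family of nodes such that $u_{\mathbf k,i}\le u_{\mathbf k',i}$ for all $i$ whenever $\mathbf k\preceq\mathbf k'$ coordinatewise. A $d$-tuple $(\boldsymbol a^{(1)},\dots,\boldsymbol a^{(d)})$ of sequences $\boldsymbol a^{(i)}=(a^{(i)}_0,\dots,a^{(i)}_{n_i-1})$ of non-negative integers is bounded by a lattice path $P$ from the origin to $\mathbf n$ (with unit steps $\mathbf e_1,\dots,\mathbf e_d$) if $a^{(i)}_{k_i}<u_{\mathbf k,i}$ for every $\mathbf e_i$-step of $P$ that starts at $\mathbf k$. The tuple is a $d$-dimensional $\boldsymbol U$-parking function if the tuple of non-decreasing rearrangements of its sequences is bounded by some such path, and it is increasing if all of its sequences are non-decreasing; let $\mathcal{IPF}^{(d)}_{\mathbf n}(\boldsymbol U)$ be the set of the increasing ones. Suppose that $\boldsymbol U=A\,\mathbb N^d+\mathbf s$, that is, $u_{\mathbf k}=A\mathbf k+\mathbf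 s$ for all $\mathbf k\in\mathbb N^d$, where $A$ is a $d\times d$ matrix over a field of characteristic zero and $\mathbf s\in\mathbb Z^d$. Put $z_{\mathbf k}=A\mathbf k$. Let $B$ be the $d\times d$ diagonal matrix with $b_{i,i}=s_i+z_{\mathbf n,i}$, and let $C$ be the $d\times d$ matrix with $c_{i,j}=-z_{n_i\mathbf e_i,\,j}$. Write $x^{(k)}=x(x+1)\cdots(x+k-1)$ for $k\ge 0$ and $x^{(-1)}=1/(x-1)$, and assume that $s_i+z_{\mathbf n,i}\neq 0$ for every $i$ with $n_i=0$. Then $\mathcal{IPF}^{(d)}_{\mathbf n}(\boldsymbol U)$ is finite and $$\#\,\mathcal{IPF}^{(d)}_{\mathbf n}(\boldsymbol U)=\frac1{n_1!\cdots n_d!}\,\det(B+C)\,\prod_{i=1}^d (s_i+z_{\mathbf n,i}+1)^{(n_i-1)}.$$ -/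

import Mathlib

/-- A lattice path from the origin to `n` in `ℕ^d` with unit steps `e_1, …, e_d`, recorded by its
sequence of steps: the step `i` adds `1` to the `i`-th coordinate. -/
structure LatticePath {d : ℕ} (n : Fin d → ℕ) where
  /-- the sequence of steps -/
  steps : List (Fin d)
  count_steps : ∀ i, steps.count i = n i

namespace LatticePath

variable {d : ℕ} {n : Fin d → ℕ}

/-- The vertex reached after the first `r` steps. -/
def vertex (P : LatticePath n) (r : ℕ) : Fin d → ℕ :=
  fun i => (P.steps.take r).count i

theorem vertex_lt (P : LatticePath n) (r : Fin P.steps.length) :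
    P.vertex r (P.steps.get r) < n (P.steps.get r) := by
  have h : (P.steps.take (r + 1)).count (P.steps.get r) ≤ P.steps.count (P.steps.get r) :=
    (List.take_sublist _ _).count_le _
  rw [P.count_steps, List.take_add_one, List.count_append] at h
  have h2 : P.steps[(r : ℕ)]?.toList.count (P.steps.get r) = 1 := by simp
  unfold vertex
  omega

end LatticePath

/-- The tuple of sequences `a` is bounded by the path `P` with respect to the nodes `U`:
for each step of `P`, say an `e_i`-step starting at the vertex `k`, one has
`a^{(i)}_{k_i} < u_{k,i}`. -/
def BoundedBy {d : ℕ} {n : Fin d → ℕ} (U : (Fin d → ℕ) → (Fin d → ℕ))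
    (a : (i : Fin d) → Fin (n i) → ℕ) (P : LatticePath n) : Prop :=
  ∀ r : Fin P.steps.length,
    a (P.steps.get r) ⟨P.vertex r (P.steps.get r), P.vertex_lt r⟩ <
      U (P.vertex r) (P.steps.get r)

/-- The order statistics of a tuple of sequences: each sequence is rearranged in non-decreasing
order. -/
def orderStatistics {d : ℕ} {n : Fin d → ℕ} (a : (i : Fin d) → Fin (n i) → ℕ) :
    (i : Fin d) → Fin (n i) → ℕ :=
  fun i => a i ∘ Tuple.sort (a i)

/-- `d`-dimensional `U`-parking functions. -/
def IsParkingFunction {d : ℕ} {n : Fin d → ℕ} (U : (Fin d → ℕ) → (Fin d → ℕ))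
    (a : (i : Fin d) → Fin (n i) → ℕ) : Prop :=
  ∃ P : LatticePath n, BoundedBy U (orderStatistics a) P

/-- The set of `d`-dimensional increasing `U`-parking functions with sequences of lengths
`n_1, …, n_d`. -/
def IPF {d : ℕ} (n : Fin d → ℕ) (U : (Fin d → ℕ) → (Fin d → ℕ)) :
    Set ((i : Fin d) → Fin (n i) → ℕ) :=
  {a | (∀ i, Monotone (a i)) ∧ IsParkingFunction U a}

/-- The node `z_k = A k` of the linear grid `A ℕ^d`. -/
def linearNode {F : Type*} [Field F] {d : ℕ} (A : Matrix (Fin d) (Fin d) F) (k : Fin d → ℕ) :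
    Fin d → F :=
  A.mulVec (fun j => (k j : F))

/-- The upper factorial `x^{(k)} = x (x+1) ⋯ (x+k-1)`, extended to negative exponents by
`x^{(-k)} = 1 / ((x-k) ⋯ (x-1))`; in particular `x^{(-1)} = 1 / (x-1)`. -/
noncomputable def upperFactorial {F : Type*} [Field F] (x : F) : ℤ → F
  | Int.ofNat k => (ascPochhammer F k).eval x
  | Int.negSucc k => ((ascPochhammer F (k + 1)).eval (x - ((k : F) + 1)))⁻¹

/-- The diagonal matrix `B` with `b_{i,i} = s_i + z_{n,i}`, where `z_k = A k`. -/
def matrixB {F : Type*} [Field F] {d : ℕ} (A : Matrix (Fin d) (Fin d) F) (s : Fin d → ℤ)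
    (n : Fin d → ℕ) : Matrix (Fin d) (Fin d) F :=
  Matrix.diagonal (fun i => (s i : F) + linearNode A n i)

/-- The matrix `C` with `c_{i,j} = - z_{n_i e_i, j}`, where `z_k = A k`. -/
def matrixC {F : Type*} [Field F] {d : ℕ} (A : Matrix (Fin d) (Fin d) F)
    (n : Fin d → ℕ) : Matrix (Fin d) (Fin d) F :=
  Matrix.of (fun i j => - linearNode A (Pi.single i (n i)) j)

/-! Monotonicity of the nodes makes the entries of `A` and `s` natural numbers. Let f(n, s) be the
number of increasing parking functions. If n_i and s_i are positive, split them by the first entry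
of the i-th sequence. If it is positive, all entries of that sequence are, and lowering them and s_i
by one loses nothing. If it is zero, some path starts with e_i, since nodes only grow, and this
entry can be removed. Hence f(n, s) = f(n, s - e_i) + f(n - e_i, s + A e_i) (`listIPF_succ`). The
determinant of `countMatrix` obeys the same recursion: row i depends only on n_i and on the i-th
coordinate of b = A n + s, the two reductions leave the other rows alone, and row i splits by
Pascal's rule (`det_countMatrix_succ`). The boundary values agree: 1 at n = 0, and 0 when n ≠ 0 but
no first step is possible (`det_countMatrix_eq_zero`). Pulling the common factor (b_i + 1)^{(n_i -
1)} / n_i! out of each row gives the product formula. -/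

/-- `Park A s a`: the tuple of sequences `a` is bounded by a lattice path with respect to the nodes
`A k + s`. A path either is empty or consists of a first step and a path for the nodes seen from the
end of that step. -/
inductive Park {d : ℕ} (A : Fin d → Fin d → ℕ) : (Fin d → ℕ) → (Fin d → List ℕ) → Prop
  | nil (s : Fin d → ℕ) : Park A s (fun _ => [])
  | step {s : Fin d → ℕ} {a : Fin d → List ℕ} (i : Fin d) (x : ℕ) (l : List ℕ) :
      a i = x :: l → x < s i → Park A (fun j => s j + A j i) (Function.update a i l) → Park A s a

/-! ### Moves on bounded tuples -/

namespace Park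

variable {d : ℕ} {A : Fin d → Fin d → ℕ}

/-- Exchange argument: moving the first e_i-step to the front of the path only enlarges the bounds
of the steps it overtakes, because `A` is non-negative, and the entry 0 stays below `s i`, which is
positive once another entry or this one can be taken. -/
theorem step_first {s : Fin d → ℕ} {a : Fin d → List ℕ} (h : Park A s a) {i : Fin d} {l : List ℕ}
    (hi : a i = 0 :: l) : Park A (fun j => s j + A j i) (Function.update a i l) := by
  induction h with
  | nil s => simp at hi
  | @step s a j y l' hj hy hp ih =>
    by_cases hij : j = i
    · subst hij
      rw [hj] at hi
      obtain ⟨rfl, rfl⟩ := List.cons.inj hi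
      exact hp
    · have hij' : i ≠ j := fun h => hij h.symm
      have := ih (by rw [Function.update_of_ne hij']; exact hi)
      refine Park.step j y l' (by rw [Function.update_of_ne hij]; exact hj)
        (by omega) ?_
      rw [Function.update_comm hij']
      simpa only [add_right_comm] using this

/-- The same path works: both sides of each inequality for an e_i-step grow by one. -/
theorem shift {s : Fin d → ℕ} {a : Fin d → List ℕ} (h : Park A s a) (i : Fin d) :
    Park A (s + Pi.single i 1) (Function.update a i ((a i).map (· + 1))) := by
  induction h with
  | nil s =>
    convert Park.nil (A := A) (s + Pi.single i 1) using 1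
    ext1 j
    by_cases hj : j = i
    · subst hj; simp
    · simp [hj]
  | @step s a j y l hj hy hp ih =>
    have hs : (fun k => (s + Pi.single i 1 : Fin d → ℕ) k + A k j) =
        (fun k => s k + A k j) + Pi.single i 1 := by
      ext k; simp only [Pi.add_apply]; omega
    by_cases hij : j = i
    · subst hij
      refine Park.step j (y + 1) (l.map (· + 1)) (by simp [hj]) (by simpa using hy) ?_
      rw [hs]
      simpa using ih
    · have hij' : i ≠ j := fun h => hij h.symm
      refine Park.step j y l (by simp [hij, hj]) (by simpa [hij] using hy) ?_
      rw [hs, Function.update_comm hij']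
      simpa [hij'] using ih

/-- Inverse of `shift`, again along the same path. The raised tuple is a variable `b` with an
equation so that induction on the derivation applies. -/
theorem unshift {s : Fin d → ℕ} {a b : Fin d → List ℕ} (i : Fin d)
    (h : Park A (s + Pi.single i 1) b) (hb : b = Function.update a i ((a i).map (· + 1))) :
    Park A s a := by
  generalize ht : s + Pi.single i 1 = t at h
  induction h generalizing s a with
  | nil t =>
    have : a = fun _ => [] := by
      ext1 j
      have h := congrFun hb j
      by_cases hj : j = i
      · subst hj; simpa using h.symm
      · simpa [hj] using h.symm
    subst this
    exact Park.nil s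
  | @step t b j y l hj hy hp ih =>
    subst ht
    have hs : (fun k => s k + A k j) + Pi.single i 1 =
        (fun k => (s + Pi.single i 1 : Fin d → ℕ) k + A k j) := by
      ext k; simp only [Pi.add_apply]; omega
    by_cases hij : j = i
    · subst hij
      rw [hb, Function.update_self] at hj
      obtain ⟨x, l', hx, rfl, rfl⟩ := List.map_eq_cons_iff.1 hj
      refine Park.step j x l' hx (by simpa using hy) (ih ?_ hs)
      simp [hb]
    · have hij' : i ≠ j := fun h => hij h.symm
      have hj' : a j = y :: l := by simpa [hb, hij] using hj
      refine Park.step j y l hj' (by simpa [hij] using hy) (ih ?_ hs)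
      rw [hb, Function.update_comm hij']
      simp [hij']

end Park

/-- The non-decreasing tuples of sequences of lengths `n` that are parking functions for the nodes
`A k + s`. -/
def listIPF {d : ℕ} (A : Fin d → Fin d → ℕ) (n s : Fin d → ℕ) : Set (Fin d → List ℕ) :=
  {a | (∀ i, (a i).Pairwise (· ≤ ·)) ∧ (∀ i, (a i).length = n i) ∧ Park A s a}

/-! ### The recursion for the number of increasing parking functions -/

section Recursion

variable {d : ℕ} {A : Fin d → Fin d → ℕ}

theorem listIPF_zero (s : Fin d → ℕ) : listIPF A 0 s = {fun _ => []} := by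
  ext a
  simp only [listIPF, Set.mem_ofPred_eq, Set.mem_singleton_iff]
  constructor
  · rintro ⟨-, h, -⟩
    ext1 i
    simpa using h i
  · rintro rfl
    exact ⟨by simp, by simp, Park.nil s⟩

/-- A nonempty path has a first step e_i, which needs an entry smaller than `s i = 0`. -/
theorem listIPF_eq_empty {n s : Fin d → ℕ} (hn : n ≠ 0) (hs : ∀ i, n i ≠ 0 → s i = 0) :
    listIPF A n s = ∅ := by
  rw [Set.eq_empty_iff_forall_notMem]
  rintro a ⟨-, hlen, hp⟩
  cases hp with
  | nil => exact hn (by ext i; simpa using (hlen i).symm)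
  | step i x l hi hx =>
    have := hs i (by rw [← hlen i, hi]; simp)
    omega

/-- Adding one to the entries of the `i`-th sequence. -/
def raise (i : Fin d) (a : Fin d → List ℕ) : Fin d → List ℕ :=
  Function.update a i ((a i).map (· + 1))

/-- Prepending a zero to the `i`-th sequence. -/
def consZero (i : Fin d) (a : Fin d → List ℕ) : Fin d → List ℕ :=
  Function.update a i (0 :: a i)

theorem raise_injective (i : Fin d) : Function.Injective (raise i) := by
  intro a b h
  ext1 j
  have hj := congrFun h j
  by_cases hij : j = i
  · subst hij
    simp only [raise, Function.update_self] at hj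
    exact List.map_injective_iff.2 (add_left_injective 1) hj
  · simpa [raise, hij] using hj

theorem consZero_injective (i : Fin d) : Function.Injective (consZero i) := by
  intro a b h
  ext1 j
  have hj := congrFun h j
  by_cases hij : j = i
  · subst hij
    simpa [consZero] using hj
  · simpa [consZero, hij] using hj

/-- The two pieces are the tuples whose i-th sequence starts with a positive entry or with 0.
`Park.unshift` and `Park.step_first` undo the two operations. -/
theorem listIPF_succ (n s : Fin d → ℕ) (i : Fin d) :
    listIPF A (n + Pi.single i 1) (s + Pi.single i 1) =
      raise i '' listIPF A (n + Pi.single i 1) s ∪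
        consZero i '' listIPF A n (fun j => (s + Pi.single i 1 : Fin d → ℕ) j + A j i) := by
  ext a
  constructor
  · rintro ⟨hmono, hlen, hp⟩
    obtain ⟨x, l, hi⟩ : ∃ x l, a i = x :: l :=
      List.exists_cons_of_length_eq_add_one (n := n i) (by simpa using hlen i)
    rcases Nat.eq_zero_or_pos x with rfl | hx
    · right
      refine ⟨Function.update a i l, ⟨fun j => ?_, fun j => ?_, hp.step_first hi⟩, ?_⟩
      · by_cases hij : j = i
        · subst hij
          have := hmono j
          rw [hi] at this
          simpa using (List.pairwise_cons.1 this).2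
        · simpa [hij] using hmono j
      · by_cases hij : j = i
        · subst hij
          have := hlen j
          rw [hi] at this
          simpa using this
        · simpa [hij] using hlen j
      · simp [consZero, ← hi]
    · left
      have hpos : ∀ y ∈ a i, 1 ≤ y := by
        intro y hy
        have := hmono i
        rw [hi] at this hy
        rcases List.mem_cons.1 hy with rfl | hy
        · exact hx
        · exact le_trans hx ((List.pairwise_cons.1 this).1 y hy)
      have hmap : ((a i).map (· - 1)).map (· + 1) = a i := by
        rw [List.map_map]
        conv_rhs => rw [← List.map_id (a i)]
        exact List.map_congr_left fun y hy => Nat.sub_add_cancel (hpos y hy)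
      have ha : raise i (Function.update a i ((a i).map (· - 1))) = a := by
        unfold raise
        rw [Function.update_self, hmap]
        simp
      refine ⟨Function.update a i ((a i).map (· - 1)), ⟨fun j => ?_, fun j => ?_, ?_⟩, ha⟩
      · by_cases hij : j = i
        · subst hij
          rw [Function.update_self]
          exact (hmono j).map _ fun x y h => Nat.sub_le_sub_right h 1
        · simpa [hij] using hmono j
      · by_cases hij : j = i
        · subst hij; simpa using hlen j
        · simpa [hij] using hlen j
      · exact hp.unshift i ha.symm
  · rintro (⟨b, ⟨hmono, hlen, hp⟩, rfl⟩ | ⟨b, ⟨hmono, hlen, hp⟩, rfl⟩)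
    · refine ⟨fun j => ?_, fun j => ?_, hp.shift i⟩
      · by_cases hij : j = i
        · subst hij
          simp only [raise, Function.update_self]
          exact (hmono j).map _ fun x y h => Nat.add_le_add_right h 1
        · simpa [raise, hij] using hmono j
      · by_cases hij : j = i
        · subst hij; simpa [raise] using hlen j
        · simpa [raise, hij] using hlen j
    · refine ⟨fun j => ?_, fun j => ?_, ?_⟩
      · by_cases hij : j = i
        · subst hij; simpa [consZero] using hmono j
        · simpa [consZero, hij] using hmono j
      · by_cases hij : j = i
        · subst hij; simpa [consZero] using hlen j
        · simpa [consZero, hij] using hlen j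
      · refine Park.step i 0 (b i) (by simp [consZero]) (by simp) ?_
        simpa [consZero] using hp

theorem disjoint_raise_consZero (n s t : Fin d → ℕ) (i : Fin d) :
    Disjoint (raise i '' listIPF A (n + Pi.single i 1) s) (consZero i '' listIPF A n t) := by
  rw [Set.disjoint_left]
  rintro _ ⟨b, -, rfl⟩ ⟨c, -, h⟩
  have := congrFun h i
  simp only [raise, consZero, Function.update_self] at this
  have h0 : 0 ∈ (b i).map (· + 1) := by rw [← this]; simp
  simp at h0

theorem finite_and_ncard_listIPF_succ {n s : Fin d → ℕ} {i : Fin d}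
    (h₁ : (listIPF A (n + Pi.single i 1) s).Finite)
    (h₂ : (listIPF A n (fun j => (s + Pi.single i 1 : Fin d → ℕ) j + A j i)).Finite) :
    (listIPF A (n + Pi.single i 1) (s + Pi.single i 1)).Finite ∧
      (listIPF A (n + Pi.single i 1) (s + Pi.single i 1)).ncard =
        (listIPF A (n + Pi.single i 1) s).ncard +
          (listIPF A n (fun j => (s + Pi.single i 1 : Fin d → ℕ) j + A j i)).ncard := by
  rw [listIPF_succ]
  refine ⟨(h₁.image _).union (h₂.image _), ?_⟩
  rw [Set.ncard_union_eq (disjoint_raise_consZero _ _ _ _) (h₁.image _) (h₂.image _),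
    Set.ncard_image_of_injective _ (raise_injective i),
    Set.ncard_image_of_injective _ (consZero_injective i)]

end Recursion

/-! ### The determinant with the same recursion and boundary values -/

section Determinant

variable {F : Type*} [Field F] {d : ℕ}

/-- The coefficient of `t ^ n` in `t / (1 - t) ^ (b + 1)`. -/
def shiftedMultichoose (b : ℕ) : ℕ → ℕ
  | 0 => 0
  | n + 1 => Nat.multichoose (b + 1) n

theorem shiftedMultichoose_succ (b n : ℕ) :
    shiftedMultichoose (b + 1) (n + 1) =
      shiftedMultichoose b (n + 1) + shiftedMultichoose (b + 1) n := by
  cases n with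
  | zero => simp [shiftedMultichoose]
  | succ n => simp only [shiftedMultichoose, Nat.multichoose_succ_succ]

theorem shiftedMultichoose_pos (b : ℕ) {n : ℕ} (hn : n ≠ 0) : shiftedMultichoose b n ≠ 0 := by
  obtain ⟨m, rfl⟩ := Nat.exists_eq_succ_of_ne_zero hn
  simp only [shiftedMultichoose, Nat.multichoose_eq]
  exact (Nat.choose_pos (by omega)).ne'

/-- Coefficients of t d/dt (1 - t)^{-b} = b t / (1 - t)^{b+1}. -/
theorem mul_shiftedMultichoose (b n : ℕ) :
    b * shiftedMultichoose b n = n * Nat.multichoose b n := by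
  cases n with
  | zero => simp [shiftedMultichoose]
  | succ n =>
    cases b with
    | zero => simp
    | succ b =>
      simp only [shiftedMultichoose, Nat.multichoose_eq]
      have h := Nat.choose_succ_right_eq (b + 1 + n) n
      have e₁ : b + 1 + 1 + n - 1 = b + 1 + n := by omega
      have e₂ : b + 1 + (n + 1) - 1 = b + 1 + n := by omega
      have e₃ : b + 1 + n - n = b + 1 := by omega
      rw [e₃] at h
      rw [e₁, e₂]
      linarith

/-- The values `A n + s` at the end point `n` of the paths. -/
def endNode (A : Fin d → Fin d → ℕ) (n s : Fin d → ℕ) (i : Fin d) : ℕ :=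
  s i + ∑ j, A i j * n j

/-- The matrix whose determinant counts the increasing parking functions. -/
def countMatrix (F : Type*) [Field F] (A : Fin d → Fin d → ℕ) (n s : Fin d → ℕ) :
    Matrix (Fin d) (Fin d) F :=
  Matrix.of fun i j =>
    (if i = j then (Nat.multichoose (endNode A n s i) (n i) : F) else 0) -
      shiftedMultichoose (endNode A n s i) (n i) * A j i

theorem det_countMatrix_zero (A : Fin d → Fin d → ℕ) (s : Fin d → ℕ) :
    (countMatrix F A 0 s).det = 1 := by
  have : countMatrix F A 0 s = 1 := by
    ext i j
    simp [countMatrix, shiftedMultichoose, Matrix.one_apply]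
  rw [this, Matrix.det_one]

/-- Linearity of the determinant in row i. Replacing (n, s) by (n - e_i, s + A e_i) keeps the end
node, while lowering s by e_i changes only its i-th coordinate; so the three matrices differ only in
row i. -/
theorem det_countMatrix_succ (A : Fin d → Fin d → ℕ) (n s : Fin d → ℕ) (i : Fin d) :
    (countMatrix F A (n + Pi.single i 1) (s + Pi.single i 1)).det =
      (countMatrix F A (n + Pi.single i 1) s).det +
        (countMatrix F A n (fun j => (s + Pi.single i 1 : Fin d → ℕ) j + A j i)).det := by
  generalize ht : (fun j => (s + Pi.single i 1 : Fin d → ℕ) j + A j i) = t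
  set N := countMatrix F A (n + Pi.single i 1) s with hN
  set K := countMatrix F A n t with hK
  have hend : ∀ j, endNode A n t j =
      endNode A (n + Pi.single i 1) s j + (if j = i then 1 else 0) := by
    intro j
    subst ht
    simp only [endNode, Pi.add_apply, mul_add, Finset.sum_add_distrib, Pi.single_apply]
    simp
    ring
  have hend' : ∀ j, endNode A (n + Pi.single i 1) (s + Pi.single i 1 : Fin d → ℕ) j =
      endNode A (n + Pi.single i 1) s j + (if j = i then 1 else 0) := by
    intro j
    simp only [endNode, Pi.add_apply, Pi.single_apply]
    ring
  have h₁ : N = N.updateRow i (N i) := by simp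
  have h₂ : K = N.updateRow i (K i) := by
    ext k j
    by_cases hk : k = i
    · subst hk; simp
    · simp [hk, hN, hK, countMatrix, hend]
  have h₃ : countMatrix F A (n + Pi.single i 1) (s + Pi.single i 1) =
      N.updateRow i (N i + K i) := by
    ext k j
    by_cases hk : k = i
    · subst hk
      simp only [Matrix.updateRow_self, Pi.add_apply, hN, hK, countMatrix, Matrix.of_apply, hend,
        hend', if_true, Pi.single_eq_same, Nat.multichoose_succ_succ, shiftedMultichoose_succ]
      push_cast
      split_ifs <;> ring
    · simp [hk, hN, countMatrix, hend']
  rw [h₃, Matrix.det_updateRow_add, ← h₂, ← h₁]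

/-- A nonzero vector in the left kernel exists because the end node has i-th coordinate (A n)_i
wherever n_i ≠ 0. -/
theorem det_countMatrix_eq_zero [CharZero F] (A : Fin d → Fin d → ℕ) {n s : Fin d → ℕ}
    (hn : n ≠ 0) (hs : ∀ i, n i ≠ 0 → s i = 0) : (countMatrix F A n s).det = 0 := by
  obtain ⟨i₀, hi₀⟩ := Function.ne_iff.1 hn
  have hi₀ : n i₀ ≠ 0 := hi₀
  have hβ : ∀ i, n i ≠ 0 → (shiftedMultichoose (endNode A n s i) (n i) : F) ≠ 0 := fun i hi =>
    Nat.cast_ne_zero.2 (shiftedMultichoose_pos _ hi)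
  rw [← Matrix.exists_vecMul_eq_zero_iff]
  -- Where n_i ≠ 0 the weight turns the subtracted part of row i into n_i A_{j,i}, so column j loses
  -- (A n)_j in total; `mul_shiftedMultichoose` makes the diagonal term equal to this. Where n_i =
  -- 0, row i is the unit row, and its weight is chosen to be (A n)_i.
  refine ⟨fun i => if n i = 0 then ((∑ j, A i j * n j : ℕ) : F)
    else (n i : F) / shiftedMultichoose (endNode A n s i) (n i), ?_, ?_⟩
  · refine Function.ne_iff.2 ⟨i₀, ?_⟩
    simp only [hi₀, if_false, Pi.zero_apply]
    exact div_ne_zero (Nat.cast_ne_zero.2 hi₀) (hβ i₀ hi₀)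
  · ext j
    simp only [Matrix.vecMul, dotProduct, countMatrix, Matrix.of_apply, Pi.zero_apply, mul_sub,
      Finset.sum_sub_distrib, mul_ite, mul_zero, Finset.sum_ite_eq', Finset.mem_univ, if_true]
    have hsum : ∀ i, (if n i = 0 then ((∑ j, A i j * n j : ℕ) : F)
        else (n i : F) / shiftedMultichoose (endNode A n s i) (n i)) *
          (shiftedMultichoose (endNode A n s i) (n i) * A j i) = A j i * n i := by
      intro i
      by_cases hi : n i = 0
      · simp [hi, shiftedMultichoose]
      · have := hβ i hi
        simp only [hi, if_false]
        field_simp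
    rw [Finset.sum_congr rfl fun i _ => hsum i]
    by_cases hj : n j = 0
    · simp [hj]
    · have h := mul_shiftedMultichoose (endNode A n s j) (n j)
      have hb : endNode A n s j = ∑ i, A j i * n i := by simp [endNode, hs j hj]
      have h' : (endNode A n s j : F) * shiftedMultichoose (endNode A n s j) (n j) =
          n j * Nat.multichoose (endNode A n s j) (n j) := by exact_mod_cast h
      have := hβ j hj
      simp only [hj, if_false]
      rw [div_mul_eq_mul_div, ← h', mul_div_cancel_right₀ _ this, hb]
      push_cast
      exact sub_self _

theorem finite_and_ncard_listIPF [CharZero F] (A : Fin d → Fin d → ℕ) (n s : Fin d → ℕ) :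
    (listIPF A n s).Finite ∧ ((listIPF A n s).ncard : F) = (countMatrix F A n s).det := by
  -- Lexicographic induction on (∑ n_i, ∑ s_i): removing a zero may increase s, but it decreases n.
  induction hN : ∑ i, n i using Nat.strong_induction_on generalizing n s with
  | _ N ihn =>
  induction hS : ∑ i, s i using Nat.strong_induction_on generalizing s with
  | _ S ihs =>
  by_cases hn : n = 0
  · subst hn
    rw [listIPF_zero, det_countMatrix_zero]
    simp
  by_cases hs : ∀ i, n i ≠ 0 → s i = 0
  · rw [listIPF_eq_empty hn hs, det_countMatrix_eq_zero A hn hs]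
    simp
  push Not at hs
  obtain ⟨i, hni, hsi⟩ := hs
  have split : ∀ m : Fin d → ℕ, m i ≠ 0 → ∃ m' : Fin d → ℕ, m = m' + Pi.single i 1 := by
    intro m hm
    refine ⟨m - Pi.single i 1, (tsub_add_cancel_of_le fun j => ?_).symm⟩
    by_cases hj : j = i
    · subst hj; simpa using Nat.one_le_iff_ne_zero.2 hm
    · simp [hj]
  obtain ⟨n, rfl⟩ := split n hni
  obtain ⟨s, rfl⟩ := split s hsi
  have h₁ := ihs (∑ i, s i) (by simp [← hS, Finset.sum_add_distrib]) s rfl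
  have h₂ := ihn (∑ i, n i) (by simp [← hN, Finset.sum_add_distrib]) n
    (fun j => (s + Pi.single i 1 : Fin d → ℕ) j + A j i) rfl
  obtain ⟨hfin, hcard⟩ := finite_and_ncard_listIPF_succ h₁.1 h₂.1
  refine ⟨hfin, ?_⟩
  rw [hcard, det_countMatrix_succ, Nat.cast_add, h₁.2, h₂.2]

end Determinant

/-! ### From lattice paths and nodes to `Park` with natural coefficients -/

section Paths

variable {d : ℕ}

/-- The tuple of sequences `a` is bounded by the path with steps `l`, for the nodes `A k + s`. -/
def ListBounded (A : Fin d → Fin d → ℕ) (s : Fin d → ℕ) (a : Fin d → List ℕ)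
    (l : List (Fin d)) : Prop :=
  ∀ r (hr : r < l.length), (a l[r]).getD ((l.take r).count l[r]) 0 <
    ∑ j, A l[r] j * (l.take r).count j + s l[r]

/-- Moving the origin to e_i turns the node at k + e_i into A k + (s + A e_i); the unit drop in the
index into the i-th sequence is offset by deleting its head. -/
theorem listBounded_cons {A : Fin d → Fin d → ℕ} {s : Fin d → ℕ} {a : Fin d → List ℕ}
    {i : Fin d} {x : ℕ} {t : List ℕ} (hi : a i = x :: t) (l : List (Fin d)) :
    ListBounded A s a (i :: l) ↔
      x < s i ∧ ListBounded A (fun j => s j + A j i) (Function.update a i t) l := by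
  have key : ∀ r (hr : r < l.length) (hr' : r + 1 < (i :: l).length),
      ((a (i :: l)[r + 1]).getD (((i :: l).take (r + 1)).count (i :: l)[r + 1]) 0 <
        ∑ j, A (i :: l)[r + 1] j * ((i :: l).take (r + 1)).count j + s (i :: l)[r + 1]) ↔
      ((Function.update a i t l[r]).getD ((l.take r).count l[r]) 0 <
        ∑ j, A l[r] j * (l.take r).count j + (s l[r] + A l[r] i)) := by
    intro r hr hr'
    simp only [List.getElem_cons_succ, List.take_succ_cons, List.count_cons, mul_add,
      Finset.sum_add_distrib]
    have e₁ : ∑ j, A l[r] j * (if (i == j) = true then 1 else 0) = A l[r] i := by simp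
    have e₂ : (a l[r]).getD ((l.take r).count l[r] + if (i == l[r]) = true then 1 else 0) 0 =
        (Function.update a i t l[r]).getD ((l.take r).count l[r]) 0 := by
      by_cases h : l[r] = i
      · simp [h, hi]
      · have h' : i ≠ l[r] := fun e => h e.symm
        simp [h, h']
    rw [e₁, e₂, add_assoc, add_comm (A l[r] i)]
  constructor
  · intro h
    have h₀ := h 0 (by simp)
    simp only [List.getElem_cons_zero] at h₀
    refine ⟨by simpa [hi] using h₀, fun r hr => ?_⟩
    exact (key r hr (by simpa using hr)).1 (h (r + 1) (by simpa using hr))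
  · rintro ⟨h₀, h⟩ r hr
    cases r with
    | zero => simpa [hi] using h₀
    | succ r => exact (key r (by simpa using hr) hr).2 (h r (by simpa using hr))

theorem count_eq_length_update {a : Fin d → List ℕ} {i : Fin d} {x : ℕ} {t : List ℕ}
    (hi : a i = x :: t) {l : List (Fin d)} :
    (∀ j, (i :: l).count j = (a j).length) ↔
      ∀ j, l.count j = (Function.update a i t j).length := by
  refine forall_congr' fun j => ?_
  by_cases h : j = i
  · subst h; simp [hi]
  · have h' : i ≠ j := fun e => h e.symm
    simp [h, h']

theorem park_iff_exists_listBounded {A : Fin d → Fin d → ℕ} {s : Fin d → ℕ}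
    {a : Fin d → List ℕ} :
    Park A s a ↔ ∃ l : List (Fin d), (∀ i, l.count i = (a i).length) ∧ ListBounded A s a l := by
  constructor
  · intro h
    induction h with
    | nil s => exact ⟨[], by simp, by simp [ListBounded]⟩
    | step i x t hi hx hp ih =>
      obtain ⟨l, hc, hb⟩ := ih
      exact ⟨i :: l, (count_eq_length_update hi).2 hc, (listBounded_cons hi l).2 ⟨hx, hb⟩⟩
  · rintro ⟨l, hc, hb⟩
    induction l generalizing s a with
    | nil =>
      have : a = fun _ => [] := by
        ext1 i
        simpa using (hc i).symm
      subst this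
      exact Park.nil s
    | cons i l ih =>
      obtain ⟨x, t, hi⟩ : ∃ x t, a i = x :: t :=
        List.exists_cons_of_length_eq_add_one (n := l.count i) (by simpa using (hc i).symm)
      obtain ⟨hx, hb⟩ := (listBounded_cons hi l).1 hb
      exact Park.step i x t hi hx (ih ((count_eq_length_update hi).1 hc) hb)

theorem orderStatistics_of_monotone {n : Fin d → ℕ} {a : (i : Fin d) → Fin (n i) → ℕ}
    (ha : ∀ i, Monotone (a i)) : orderStatistics a = a := by
  ext1 i
  rw [orderStatistics, Tuple.sort_eq_refl_iff_monotone.2 (ha i)]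
  rfl

/-- A tuple of finite sequences as a tuple of lists. -/
def toLists {n : Fin d → ℕ} (a : (i : Fin d) → Fin (n i) → ℕ) (i : Fin d) : List ℕ :=
  List.ofFn (a i)

theorem toLists_injective (n : Fin d → ℕ) :
    Function.Injective (toLists : ((i : Fin d) → Fin (n i) → ℕ) → Fin d → List ℕ) := by
  intro a b h
  ext1 i
  exact List.ofFn_injective (congrFun h i)

theorem boundedBy_iff_listBounded {A : Fin d → Fin d → ℕ} {s n : Fin d → ℕ}
    {U : (Fin d → ℕ) → (Fin d → ℕ)} (hU : ∀ k i, U k i = ∑ j, A i j * k j + s i)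
    (a : (i : Fin d) → Fin (n i) → ℕ) (P : LatticePath n) :
    BoundedBy U a P ↔ ListBounded A s (toLists a) P.steps := by
  unfold BoundedBy ListBounded
  rw [Fin.forall_iff]
  refine forall₂_congr fun r hr => ?_
  have h := P.vertex_lt ⟨r, hr⟩
  simp only [List.get_eq_getElem, LatticePath.vertex] at h
  -- By `h` the index is in range, so the default value of `getD` is never read.
  simp [hU, toLists, LatticePath.vertex, List.getD_eq_getElem?_getD, h]

theorem toLists_image_IPF {A : Fin d → Fin d → ℕ} {s : Fin d → ℕ} (n : Fin d → ℕ)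
    {U : (Fin d → ℕ) → (Fin d → ℕ)} (hU : ∀ k i, U k i = ∑ j, A i j * k j + s i) :
    toLists '' IPF n U = listIPF A n s := by
  have hpark : ∀ a : (i : Fin d) → Fin (n i) → ℕ,
      (∃ P : LatticePath n, BoundedBy U a P) ↔ Park A s (toLists a) := by
    intro a
    rw [park_iff_exists_listBounded]
    constructor
    · rintro ⟨P, hP⟩
      exact ⟨P.steps, by simpa [toLists] using P.count_steps,
        (boundedBy_iff_listBounded hU a P).1 hP⟩
    · rintro ⟨l, hc, hb⟩
      exact ⟨⟨l, by simpa [toLists] using hc⟩, (boundedBy_iff_listBounded hU a _).2 hb⟩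
  ext b
  constructor
  · rintro ⟨a, ⟨hmono, hp⟩, rfl⟩
    unfold IsParkingFunction at hp
    rw [orderStatistics_of_monotone hmono, hpark] at hp
    exact ⟨fun i => (hmono i).sortedLE_ofFn.pairwise, by simp [toLists], hp⟩
  · rintro ⟨hmono, hlen, hp⟩
    obtain ⟨a, rfl⟩ : ∃ a : (i : Fin d) → Fin (n i) → ℕ, toLists a = b := by
      refine ⟨fun i j => (b i)[j]'(by rw [hlen]; exact j.2), ?_⟩
      ext1 i
      refine List.ext_getElem (by simp [toLists, hlen]) ?_
      simp [toLists]
    have hmono' : ∀ i, Monotone (a i) := fun i =>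
      List.sortedLE_ofFn_iff.1 (hmono i).sortedLE
    refine ⟨a, ⟨hmono', ?_⟩, rfl⟩
    unfold IsParkingFunction
    rwa [orderStatistics_of_monotone hmono', hpark]

/-- The constant term is the node at 0, and column j of the matrix is the difference of the nodes at
e_j and 0, which is non-negative by monotonicity. -/
theorem exists_nat_of_monotone_affine {F : Type*} [Field F] [CharZero F]
    {A : Matrix (Fin d) (Fin d) F} {s : Fin d → ℤ}
    {U : (Fin d → ℕ) → (Fin d → ℕ)} (hmono : Monotone U)
    (haff : ∀ (k : Fin d → ℕ) (i : Fin d), (U k i : F) = linearNode A k i + (s i : F)) :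
    ∃ (A' : Fin d → Fin d → ℕ) (s' : Fin d → ℕ), (∀ i j, A i j = A' i j) ∧
      (∀ i, (s i : F) = s' i) ∧ ∀ k i, U k i = ∑ j, A' i j * k j + s' i := by
  have hs : ∀ i, (s i : F) = U 0 i := fun i => by
    simp [haff, linearNode, Matrix.mulVec, dotProduct]
  have hA : ∀ i j, A i j = (U (Pi.single j 1) i - U 0 i : ℕ) := fun i j => by
    rw [Nat.cast_sub (hmono zero_le i), haff, ← hs]
    simp [linearNode, Matrix.mulVec, dotProduct, Pi.single_apply]
  refine ⟨_, _, hA, hs, fun k i => ?_⟩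
  have h := haff k i
  simp only [linearNode, Matrix.mulVec, dotProduct, hA, hs] at h
  exact_mod_cast h

end Paths

/-! ### Extraction of the row factors -/

section Formula

variable {F : Type*} [Field F] {d : ℕ}

theorem upperFactorial_eq (b n : ℕ) :
    upperFactorial ((b : F) + 1) (((n + 1 : ℕ) : ℤ) - 1) =
      n.factorial * Nat.multichoose (b + 1) n := by
  have : ((n + 1 : ℕ) : ℤ) - 1 = Int.ofNat n := by simp
  rw [this]
  simp only [upperFactorial]
  have h := ascPochhammer_nat_eq_natCast_ascFactorial F (b + 1) n
  push_cast at h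
  rw [h, Nat.ascFactorial_eq_factorial_mul_choose, Nat.multichoose_eq]
  have : b + 1 + n - 1 = b + n := by omega
  push_cast
  rw [this]

theorem upperFactorial_neg_one (b : F) : upperFactorial (b + 1) (((0 : ℕ) : ℤ) - 1) = b⁻¹ := by
  have : ((0 : ℕ) : ℤ) - 1 = Int.negSucc 0 := rfl
  rw [this]
  simp [upperFactorial]

/-- With b the i-th end value, the multichoose number is b (b + 1)^{(n_i - 1)} / n_i! and the
shifted one is n_i (b + 1)^{(n_i - 1)} / n_i!, so row i has a common factor. For n_i = 0 this factor
is 1/b, whence the hypothesis b ≠ 0. -/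
theorem det_countMatrix_eq [CharZero F] (A : Fin d → Fin d → ℕ) (n s : Fin d → ℕ)
    (hn : ∀ i, n i = 0 → (endNode A n s i : F) ≠ 0) :
    (countMatrix F A n s).det =
      (∏ i, upperFactorial ((endNode A n s i : F) + 1) ((n i : ℤ) - 1) / (n i).factorial) *
        Matrix.det (Matrix.of fun i j : Fin d =>
          (if i = j then (endNode A n s i : F) else 0) - n i * A j i) := by
  rw [← Matrix.det_mul_column]
  congr 1
  ext i j
  simp only [countMatrix, Matrix.of_apply]
  have h := mul_shiftedMultichoose (endNode A n s i) (n i)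
  have hb := hn i
  generalize endNode A n s i = b at *
  rcases hni : n i with _ | m
  · have := hb hni
    rw [upperFactorial_neg_one]
    by_cases hij : i = j
    · simp [hij, shiftedMultichoose, this]
    · simp [hij, shiftedMultichoose]
  · rw [hni] at h
    simp only [shiftedMultichoose] at h
    rw [upperFactorial_eq, Nat.factorial_succ]
    have hm : ((m : F) + 1) ≠ 0 := by exact_mod_cast Nat.succ_ne_zero m
    have hf : (m.factorial : F) ≠ 0 := by exact_mod_cast m.factorial_ne_zero
    have h' : (b : F) * Nat.multichoose (b + 1) m = (m + 1) * Nat.multichoose b (m + 1) := by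
      exact_mod_cast h
    simp only [shiftedMultichoose]
    push_cast
    have e : (Nat.multichoose b (m + 1) : F) = b * Nat.multichoose (b + 1) m / (m + 1) := by
      rw [h']; field_simp
    rw [e]
    split_ifs <;> (field_simp; try ring)

end Formula

theorem proposition17 {F : Type*} [Field F] [CharZero F] {d : ℕ}
    (n : Fin d → ℕ) (A : Matrix (Fin d) (Fin d) F) (s : Fin d → ℤ)
    (U : (Fin d → ℕ) → (Fin d → ℕ)) (hmono : Monotone U)
    (haff : ∀ (k : Fin d → ℕ) (i : Fin d), (U k i : F) = linearNode A k i + (s i : F))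
    (hn : ∀ i, n i = 0 → (s i : F) + linearNode A n i ≠ 0) :
    (IPF n U).Finite ∧
      ((IPF n U).ncard : F) =
        (1 / ((∏ i, (n i).factorial : ℕ) : F)) * (matrixB A s n + matrixC A n).det *
          ∏ i, upperFactorial ((s i : F) + linearNode A n i + 1) ((n i : ℤ) - 1) := by
  obtain ⟨A', s', hA, hs, hU⟩ := exists_nat_of_monotone_affine hmono haff
  have himage := toLists_image_IPF n hU
  obtain ⟨hfin, hcard⟩ := finite_and_ncard_listIPF (F := F) A' n s'
  have hend : ∀ i, (s i : F) + linearNode A n i = (endNode A' n s' i : F) := fun i => by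
    simp [hs, hA, linearNode, endNode, Matrix.mulVec, dotProduct]
  have hmatrix : matrixB A s n + matrixC A n = Matrix.of fun i j : Fin d =>
      (if i = j then (endNode A' n s' i : F) else 0) - n i * A' j i := by
    ext i j
    simp only [matrixB, matrixC, hend, Matrix.add_apply, Matrix.diagonal_apply, Matrix.of_apply]
    simp [linearNode, Matrix.mulVec, dotProduct, hA,
      Pi.single_apply, sub_eq_add_neg, mul_comm]
  refine ⟨Set.Finite.of_finite_image (himage ▸ hfin) (toLists_injective n).injOn, ?_⟩
  rw [← Set.ncard_image_of_injective _ (toLists_injective n), himage, hcard,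
    det_countMatrix_eq A' n s' fun i hi => hend i ▸ hn i hi, hmatrix, Finset.prod_div_distrib]
  simp only [hend]
  push_cast
  ring
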